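/- Comparison functions. $\mathcal K$: continuous strictly increasing $\gamma:[0,\infty)\to[0,\infty)$ with $\gamma(0)=0$; $\mathcal K_\infty$: the unbounded ones; $\mathcal{L}$: continuous, strictly decreasing functions $[0,\infty)\to[0,\infty)$ with limit $0$ at $\infty$; $\mathcal{KL}$: continuous $\beta:[0,\infty)^2\to[0,\infty)$ with $\beta(\cdot,t)\in\mathcal K$ for all $t\ge0$ and $\beta(r,\cdot)\in\mathcal L$ for all $r>0$. System. Let $X$ be a real or complex Hilbert space and $U$ a normed linear space. For $t\ge 0$ let $A(t):D(A(t))\subset X\to X$ be a (possibly unbounded) linear operator and let $F(t,\cdot,\cdot):X_F(t)\times U\to X$, where $X_F(t)$ is a linear subspace of $X$ containing $D(A(t))$ (for instance a fractional power space of $A(t)$). Consider $$\dot x(t)=A(t)x(t)+F(t,x(t),u(t)),\qquad x(0)=x_0,\tag{1}$$ with $x_0\in D(A(0))$ and $u\in C([0,\infty);U)$. A classical solution on $[0,T)$, $0<T\le\infty$, is a function $x:[0,T)\to X$ that is continuous on $[0,T)$, continuously differentiable on $(0,T)$, satisfies $x(t)\in D(A(t))$ and the differential equation for $t\in(0,T)$,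 and $x(0)=x_0$. (1) is iISS if there are $\beta\in\mathcal{KL}$, $\sigma\in\mathcal K_\infty$, $\gamma\in\mathcal K$ such that for all $x_0\in D(A(0))$ and $u\in C([0,\infty);U)$ every classical solution $x$, on any interval $[0,T)$ with $0<T\le\infty$, satisfies $\|x(t)\|\le\beta(\|x_0\|,t)+\sigma\big(\int_0^t\gamma(\|u(s)\|)\,ds\big)$ for all $t\in[0,T)$. It is LiISS if this holds, for some such $\beta,\sigma,\gamma$ and some $R>0$, $\sigma_0\in\mathcal K_\infty$, $\gamma_0\in\mathcal K$, for all those $(x_0,u)$ with $\|x_0\|+\sigma_0\big(\int_0^t\gamma_0(\|u(s)\|)\,ds\big)\le R$ for all $t>0$. A $C^1$ functional $V:[0,\infty)\times X\to[0,\infty)$ is an LiISS Lyapunov functional of (1) if (i) $\alpha_1(\|x\|)\le V(t,x)\le\alpha_2(\|x\|)$ for all $t\ge0$, $x\in X$, with some $\alpha_1,\alpha_2\in\mathcal K_\infty$; and (ii) there are nonnegative locally integrable $g_1,g_2$ on $[0,\infty)$ with $g_2\le g_1$ and $\int_0^\infty g_1=\infty$, functions $\theta_1,\theta_2,\phi\in\mathcal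 K$ and $R'>0$ with $\theta_2\le\theta_1$ on $[0,R']$, such that for all $t\ge0$, $x\in D(A(t))$, $u\in U$ the derivative $\dot V(t,x)$ of $V$ at $(t,x)$ in the direction $(1,A(t)x+F(t,x,u))$ satisfies $\dot V(t,x)\le-g_1(t)\theta_1(\|x\|)+g_2(t)\theta_2(\|x\|)+\phi(\|u\|)$. It is an iISS Lyapunov functional if (i) and (ii) hold with $g_2\equiv0$. Theorem. Let $P:[0,\infty)\to\mathscr L(X)$ be continuously differentiable, with every $P(t)$ self-adjoint and positive, uniformly bounded ($\sup_t\|P(t)\|<\infty$) and uniformly coercive ($\langle P(t)x,x\rangle\ge c\|x\|^2$ for all $t\ge 0$, $x\in X$, with a constant $c>0$). Let $a_1,a_2$ be nonnegative and locally integrable on $[0,\infty)$ with $\lim_{t\to\infty}\int_0^t a_1(\tau)\,d\tau=\infty$ and $a_2(t)\le M a_1(t)$ for all $t\ge0$, where $M\ge0$ is a constant; let $m_1,m_2>2$ and $\zeta\in\mathcal K$. Suppose that $$\langle(A^*(t)P(t)+P(t)A(t)+\dot P(t))x,x\rangle+2\langle F(t,x,u),P(t)x\rangle\le-a_1(t)\|x\|^2+a_2(t)\big(\|x\|^{m_1}+\|x\|^{m_2}\big)+\zeta(\|u\|)$$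 for all $t\ge0$, $x\in D(A(t))$, $u\in U$, where $\langle A^*(t)P(t)x,x\rangle$ is understood as $\langle P(t)x,A(t)x\rangle$ and, in a complex space, real parts are taken. Then $V(t,x)=\langle P(t)x,x\rangle$ is an LiISS Lyapunov functional of (1), and (1) is LiISS. If moreover $a_2\equiv0$, then $V$ is an iISS Lyapunov functional of (1), and (1) is iISS. -/

import Mathlib

open Set Filter Topology MeasureTheory

/-- Comparison functions of class `K` (only the values on `[0, ∞)` matter). -/
structure IsClassK (γ : ℝ → ℝ) : Prop where
  continuousOn : ContinuousOn γ (Ici 0)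
  strictMonoOn : StrictMonoOn γ (Ici 0)
  map_zero : γ 0 = 0

/-- Class `K∞`: unbounded functions of class `K`. -/
structure IsClassKInf (γ : ℝ → ℝ) : Prop where
  isClassK : IsClassK γ
  unbounded : ¬ BddAbove (γ '' Ici 0)

/-- Class `L`: continuous, strictly decreasing to `0` on `[0, ∞)`. -/
structure IsClassL (γ : ℝ → ℝ) : Prop where
  continuousOn : ContinuousOn γ (Ici 0)
  strictAntiOn : StrictAntiOn γ (Ici 0)
  tendsto_zero : Tendsto γ atTop (𝓝 0)

/-- Class `KL`. -/
structure IsClassKL (β : ℝ → ℝ → ℝ) : Prop where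
  continuousOn : ContinuousOn (Function.uncurry β) (Ici 0 ×ˢ Ici 0)
  isClassK : ∀ t : ℝ, 0 ≤ t → IsClassK (fun r => β r t)
  isClassL : ∀ r : ℝ, 0 < r → IsClassL (fun t => β r t)

/-- The data of a non-autonomous evolution equation `x' = A(t) x + F(t, x, u)`.
Here `A(t)` is a (possibly unbounded) linear operator with domain `D(A(t))`, and the nonlinearity
`F(t, ·, ·)` is defined on a subspace of `X` that contains `D(A(t))` (such as a fractional power
space of `A(t)`). Only the times `t ≥ 0` matter. -/
structure EvolutionSystem (𝕜 X U : Type*) [RCLike 𝕜] [NormedAddCommGroup X] [NormedSpace 𝕜 X] where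
  A : ℝ → X →ₗ.[𝕜] X
  domF : ℝ → Submodule 𝕜 X
  domain_le : ∀ t, (A t).domain ≤ domF t
  F : (t : ℝ) → domF t → U → X

namespace EvolutionSystem

section Banach

variable {𝕜 X U : Type*} [RCLike 𝕜] [NormedAddCommGroup X] [NormedSpace 𝕜 X]
  [NormedSpace ℝ X] [NormedAddCommGroup U]

/-- The nonlinearity evaluated at a point of `D(A(t))`. -/
def nonlin (S : EvolutionSystem 𝕜 X U) (t : ℝ) (x : (S.A t).domain) (u : U) : X :=
  S.F t (Submodule.inclusion (S.domain_le t) x) u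

/-- The right-hand side `A(t) x + F(t, x, u)` for `x ∈ D(A(t))`. -/
def rhs (S : EvolutionSystem 𝕜 X U) (t : ℝ) (x : (S.A t).domain) (u : U) : X :=
  S.A t x + S.nonlin t x u

/-- `x` is a classical solution on `[0, T)`, where `0 < T ≤ ∞`, with initial state `x₀` and
input `u`. -/
structure IsClassicalSolution (S : EvolutionSystem 𝕜 X U) (x₀ : X) (u : ℝ → U) (T : EReal)
    (x : ℝ → X) : Prop where
  pos : 0 < T
  continuousOn : ContinuousOn x {t : ℝ | 0 ≤ t ∧ (t : EReal) < T}
  contDiffOn : ContDiffOn ℝ 1 x {t : ℝ | 0 < t ∧ (t : EReal) < T}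
  mem_domain : ∀ t : ℝ, 0 < t → (t : EReal) < T → x t ∈ (S.A t).domain
  hasDerivAt : ∀ (t : ℝ) (h0 : 0 < t) (hT : (t : EReal) < T),
    HasDerivAt x (S.rhs t ⟨x t, mem_domain t h0 hT⟩ (u t)) t
  initial : x 0 = x₀

/-- All classical solutions with initial state `x₀` and input `u`, on whatever time interval
`[0, T)` with `0 < T ≤ ∞` they are defined, satisfy the integral input-to-state estimate. -/
def SatisfiesEstimate (S : EvolutionSystem 𝕜 X U) (β : ℝ → ℝ → ℝ) (σ γ : ℝ → ℝ)
    (x₀ : X) (u : ℝ → U) : Prop :=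
  ∀ (T : EReal) (x : ℝ → X), S.IsClassicalSolution x₀ u T x →
    ∀ t : ℝ, 0 ≤ t → (t : EReal) < T →
      ‖x t‖ ≤ β ‖x₀‖ t + σ (∫ s in (0 : ℝ)..t, γ ‖u s‖)

/-- Integral input-to-state stability. -/
def IsIISS (S : EvolutionSystem 𝕜 X U) : Prop :=
  ∃ (β : ℝ → ℝ → ℝ) (σ γ : ℝ → ℝ), IsClassKL β ∧ IsClassKInf σ ∧ IsClassK γ ∧
    ∀ (x₀ : X) (u : ℝ → U), x₀ ∈ (S.A 0).domain → ContinuousOn u (Ici 0) →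
      S.SatisfiesEstimate β σ γ x₀ u

/-- Local integral input-to-state stability. -/
def IsLiISS (S : EvolutionSystem 𝕜 X U) : Prop :=
  ∃ (β : ℝ → ℝ → ℝ) (σ γ : ℝ → ℝ) (R : ℝ) (σ₀ γ₀ : ℝ → ℝ),
    IsClassKL β ∧ IsClassKInf σ ∧ IsClassK γ ∧ 0 < R ∧ IsClassKInf σ₀ ∧ IsClassK γ₀ ∧
    ∀ (x₀ : X) (u : ℝ → U), x₀ ∈ (S.A 0).domain → ContinuousOn u (Ici 0) →
      (∀ t : ℝ, 0 < t → ‖x₀‖ + σ₀ (∫ s in (0 : ℝ)..t, γ₀ ‖u s‖) ≤ R) →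
      S.SatisfiesEstimate β σ γ x₀ u

/-- The derivative of `V` along the system at time `t`, state `x ∈ D(A(t))` and input value `u`:
the derivative of `V` at `(t, x)` (one-sided in time at `t = 0`) in the direction
`(1, A(t) x + F(t, x, u))`. -/
noncomputable def orbitalDeriv (S : EvolutionSystem 𝕜 X U) (V : ℝ → X → ℝ) (t : ℝ)
    (x : (S.A t).domain) (u : U) : ℝ :=
  fderivWithin ℝ (Function.uncurry V) (Ici 0 ×ˢ univ) (t, (x : X)) (1, S.rhs t x u)

/-- `V` is continuously differentiable on `[0, ∞) × X` and lies between two `K∞` functions of the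
norm of the state. -/
def IsLyapunovCandidate (V : ℝ → X → ℝ) : Prop :=
  ContDiffOn ℝ 1 (Function.uncurry V) (Ici (0 : ℝ) ×ˢ (univ : Set X)) ∧
  ∃ α₁ α₂ : ℝ → ℝ, IsClassKInf α₁ ∧ IsClassKInf α₂ ∧
    ∀ t : ℝ, 0 ≤ t → ∀ x : X, α₁ ‖x‖ ≤ V t x ∧ V t x ≤ α₂ ‖x‖

/-- The dissipation inequality for `V` with time-dependent gains `g₁`, `g₂`. -/
def Dissipation (S : EvolutionSystem 𝕜 X U) (V : ℝ → X → ℝ) (g₁ g₂ : ℝ → ℝ) : Prop :=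
  LocallyIntegrableOn g₁ (Ici 0) ∧ LocallyIntegrableOn g₂ (Ici 0) ∧
  (∀ t : ℝ, 0 ≤ t → 0 ≤ g₁ t ∧ 0 ≤ g₂ t ∧ g₂ t ≤ g₁ t) ∧
  Tendsto (fun t : ℝ => ∫ τ in (0 : ℝ)..t, g₁ τ) atTop atTop ∧
  ∃ (θ₁ θ₂ φ : ℝ → ℝ) (R : ℝ), IsClassK θ₁ ∧ IsClassK θ₂ ∧ IsClassK φ ∧ 0 < R ∧
    (∀ s ∈ Icc 0 R, θ₂ s ≤ θ₁ s) ∧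
    ∀ t : ℝ, 0 ≤ t → ∀ (x : (S.A t).domain) (u : U),
      S.orbitalDeriv V t x u ≤ -g₁ t * θ₁ ‖(x : X)‖ + g₂ t * θ₂ ‖(x : X)‖ + φ ‖u‖

/-- `V` is an LiISS Lyapunov functional of the system. -/
def IsLiISSLyapunov (S : EvolutionSystem 𝕜 X U) (V : ℝ → X → ℝ) : Prop :=
  IsLyapunovCandidate V ∧ ∃ g₁ g₂ : ℝ → ℝ, S.Dissipation V g₁ g₂

/-- `V` is an iISS Lyapunov functional of the system: the gain `g₂` vanishes identically. -/
def IsIISSLyapunov (S : EvolutionSystem 𝕜 X U) (V : ℝ → X → ℝ) : Prop :=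
  IsLyapunovCandidate V ∧ ∃ g₁ g₂ : ℝ → ℝ, (∀ t : ℝ, 0 ≤ t → g₂ t = 0) ∧ S.Dissipation V g₁ g₂

end Banach

end EvolutionSystem

section Hilbert

variable {𝕜 X : Type*} [RCLike 𝕜] [NormedAddCommGroup X] [InnerProductSpace 𝕜 X]

/-- The quadratic form `⟨(A* P + P A + Q) x, x⟩` for `x ∈ D(A)`, where `⟨A* P x, x⟩` is read as
`⟨P x, A x⟩`, which makes sense without requiring `P x ∈ D(A*)`
(see `lyapunovForm_eq_of_mem_adjoint`). In a complex space the real part is taken. -/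
noncomputable def lyapunovForm (A : X →ₗ.[𝕜] X) (P Q : X →L[𝕜] X) (x : A.domain) : ℝ :=
  RCLike.re (inner 𝕜 (P x) (A x) + inner 𝕜 (P (A x)) (x : X) + inner 𝕜 (Q x) (x : X))

/-- If `A` is densely defined and `P x ∈ D(A*)`, the form is literally
`⟨(A* P + P A + Q) x, x⟩`. -/
theorem lyapunovForm_eq_of_mem_adjoint [CompleteSpace X] (A : X →ₗ.[𝕜] X)
    (hA : Dense (A.domain : Set X)) (P Q : X →L[𝕜] X) (x : A.domain)
    (hx : P x ∈ A.adjoint.domain) :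
    lyapunovForm A P Q x =
      RCLike.re (inner 𝕜 (A.adjoint ⟨P x, hx⟩ + P (A x) + Q x) (x : X)) := by
  have h := LinearPMap.adjoint_isFormalAdjoint hA ⟨P x, hx⟩ x
  rw [inner_add_left, inner_add_left, lyapunovForm]
  rw [h]

end Hilbert

/-!
Since `P(t)` is symmetric, the derivative of `V(t, x) = re ⟨P(t) x, x⟩` in the direction
`(1, A(t) x + F(t, x, u))` is exactly the left-hand side of the assumed inequality
(`orbitalDeriv_re_inner_apply`), and `c ‖x‖² ≤ V ≤ C ‖x‖²` by coercivity and boundedness. This gives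
the Lyapunov property, with gains `g₁ = a₁` and `g₂ = a₂ / (M + 1)`: the exponents `m₁, m₂` exceed
`2`, so the positive term is dominated near the origin.

For stability, on a small ball of radius `ρ` the superquadratic terms absorb at most half of the
decay, so that `V' ≤ -a V / C + ζ(‖u‖)` along solutions, with `a = a₁ / 2`
(if `a₂ = 0`, this holds everywhere with `a = a₁`). A Gronwall estimate
(`le_mul_exp_add_integral_of_deriv_le`) yields
`c ‖x(t)‖² ≤ C ‖x₀‖² exp (-∫₀ᵗ a / C) + ∫₀ᵗ ζ(‖u‖)`, and taking square roots gives the estimate with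
`β(r, t) = √(C / c) r (exp (-∫₀ᵗ a / (2C)) + exp (-t))` and `σ(s) = √(s / c)`. That `∫₀ᵗ a → ∞` makes
`β` of class `KL`. Solutions with small data stay in the ball by a first-exit-time argument
(`IsClassicalSolution.norm_lt_of_decay_on_ball`).
-/

/-! ### A Gronwall estimate with a locally integrable rate -/

/-- Here `k` is merely integrable, so `exp (∫ k)` need not be differentiable. Instead, for
`w = W - ∫ z` one has `(log w)' ≤ -k` wherever `w > 0`, and `w` is nonincreasing. -/
theorem le_mul_exp_add_integral_of_deriv_le {W W' k z : ℝ → ℝ} {b : ℝ} (hb : 0 ≤ b)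
    (hWc : ContinuousOn W (Icc 0 b)) (hW0 : ∀ s ∈ Icc 0 b, 0 ≤ W s)
    (hWd : ∀ s ∈ Ioo 0 b, HasDerivAt W (W' s) s)
    (hk : ∀ s ∈ Ioo 0 b, 0 ≤ k s) (hki : IntegrableOn k (Icc 0 b))
    (hzc : ContinuousOn z (Ici 0)) (hz : ∀ s, 0 ≤ s → 0 ≤ z s)
    (hle : ∀ s ∈ Ioo 0 b, W' s ≤ -k s * W s + z s) :
    W b ≤ W 0 * Real.exp (-∫ s in (0 : ℝ)..b, k s) + ∫ s in (0 : ℝ)..b, z s := by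
  set h : ℝ → ℝ := fun t => ∫ s in (0 : ℝ)..t, z s with hh
  have hzi : ∀ t, 0 ≤ t → IntervalIntegrable z volume 0 t := fun t ht =>
    (hzc.mono (by rw [uIcc_of_le ht]; exact Icc_subset_Ici_self)).intervalIntegrable
  have hhd : ∀ s, 0 < s → HasDerivAt h (z s) s := by
    intro s hs
    refine intervalIntegral.integral_hasDerivAt_right (hzi s hs.le) ?_
      (hzc.continuousAt (Ici_mem_nhds hs))
    exact (hzc.mono Ioi_subset_Ici_self).stronglyMeasurableAtFilter isOpen_Ioi s hs
  have hhc : ContinuousOn h (Icc 0 b) := by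
    have := intervalIntegral.continuousOn_primitive_interval' (hzi b hb) (left_mem_uIcc)
    rwa [uIcc_of_le hb] at this
  have hhn : ∀ s, 0 ≤ s → 0 ≤ h s := fun s hs =>
    intervalIntegral.integral_nonneg hs fun r hr => hz r hr.1
  have hh0 : h 0 = 0 := by simp [hh]
  set w : ℝ → ℝ := fun s => W s - h s with hw
  have hwc : ContinuousOn w (Icc 0 b) := hWc.sub hhc
  have hwd : ∀ s ∈ Ioo 0 b, HasDerivAt w (W' s - z s) s := fun s hs =>
    (hWd s hs).sub (hhd s hs.1)
  have hanti : AntitoneOn w (Icc 0 b) := by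
    refine antitoneOn_of_hasDerivWithinAt_nonpos (f' := fun s => W' s - z s)
      (convex_Icc 0 b) hwc ?_ ?_
    · intro s hs
      rw [interior_Icc] at hs ⊢
      exact (hwd s hs).hasDerivWithinAt
    · intro s hs
      rw [interior_Icc] at hs
      nlinarith [hle s hs, mul_nonneg (hk s hs) (hW0 s (Ioo_subset_Icc_self hs))]
  suffices H : w b ≤ W 0 * Real.exp (-∫ s in (0 : ℝ)..b, k s) by
    have : W b = w b + h b := by simp [hw]
    linarith
  have hw00 : w 0 = W 0 := by simp [hw, hh0]
  rcases le_or_gt (w b) 0 with hwb | hwb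
  · exact hwb.trans (mul_nonneg (hW0 0 ⟨le_rfl, hb⟩) (Real.exp_nonneg _))
  have hpos : ∀ s ∈ Icc 0 b, 0 < w s := fun s hs =>
    hwb.trans_le (hanti hs ⟨hb, le_rfl⟩ hs.2)
  have hlog : Real.log (w b) - Real.log (w 0) ≤ ∫ s in (0 : ℝ)..b, -k s := by
    refine intervalIntegral.sub_le_integral_of_hasDeriv_right_of_le (g := fun s => Real.log (w s))
      (g' := fun s => (W' s - z s) / w s) hb
      (hwc.log fun s hs => (hpos s hs).ne') ?_ hki.neg ?_
    · intro s hs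
      exact ((hwd s hs).log (hpos s (Ioo_subset_Icc_self hs)).ne').hasDerivWithinAt
    · intro s hs
      rw [div_le_iff₀ (hpos s (Ioo_subset_Icc_self hs))]
      have h1 := hle s hs
      have h2 := mul_nonneg (hk s hs) (hhn s hs.1.le)
      simp only [hw]
      nlinarith
  rw [intervalIntegral.integral_neg] at hlog
  have h0 := hpos 0 ⟨le_rfl, hb⟩
  calc w b = Real.exp (Real.log (w b)) := (Real.exp_log hwb).symm
    _ ≤ Real.exp (Real.log (w 0) + -∫ s in (0 : ℝ)..b, k s) := Real.exp_le_exp.2 (by linarith)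
    _ = W 0 * Real.exp (-∫ s in (0 : ℝ)..b, k s) := by
      rw [Real.exp_add, Real.exp_log h0, hw00]

/-! ### Comparison functions -/

theorem isClassKInf_of_tendsto {γ : ℝ → ℝ} (hc : ContinuousOn γ (Ici 0))
    (hm : StrictMonoOn γ (Ici 0)) (h0 : γ 0 = 0) (ht : Tendsto γ atTop atTop) :
    IsClassKInf γ := by
  refine ⟨⟨hc, hm, h0⟩, ?_⟩
  rintro ⟨B, hB⟩
  obtain ⟨s, hs, hs0⟩ := ((ht.eventually_gt_atTop B).and (eventually_ge_atTop 0)).exists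
  exact absurd (hB ⟨s, hs0, rfl⟩) (not_le.2 hs)

theorem isClassKInf_id : IsClassKInf (fun s => s) :=
  isClassKInf_of_tendsto continuousOn_id (strictMono_id.strictMonoOn _) rfl tendsto_id

theorem isClassKInf_mul_sq {c : ℝ} (hc : 0 < c) : IsClassKInf (fun s => c * s ^ 2) := by
  refine isClassKInf_of_tendsto (by fun_prop) ?_ (by simp)
    ((tendsto_pow_atTop two_ne_zero).const_mul_atTop hc)
  intro a ha b _ hab
  exact mul_lt_mul_of_pos_left (pow_lt_pow_left₀ hab ha two_ne_zero) hc

theorem isClassKInf_sqrt_div {c : ℝ} (hc : 0 < c) : IsClassKInf (fun s => √(s / c)) := by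
  refine isClassKInf_of_tendsto (by fun_prop) ?_ (by simp)
    (Real.tendsto_sqrt_atTop.comp (tendsto_id.atTop_div_const hc))
  intro a ha b _ hab
  exact Real.sqrt_lt_sqrt (div_nonneg ha hc.le) (div_lt_div_of_pos_right hab hc)

theorem isClassK_mul_rpow_add_rpow {L m₁ m₂ : ℝ} (hL : 0 < L) (hm₁ : 0 < m₁) (hm₂ : 0 < m₂) :
    IsClassK (fun s => L * (s ^ m₁ + s ^ m₂)) := by
  refine ⟨?_, ?_, ?_⟩
  · exact (continuousOn_const.mul
      ((Real.continuous_rpow_const hm₁.le).add (Real.continuous_rpow_const hm₂.le)).continuousOn)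
  · intro a ha b _ hab
    exact mul_lt_mul_of_pos_left
      (add_lt_add (Real.rpow_lt_rpow ha hab hm₁) (Real.rpow_lt_rpow ha hab hm₂)) hL
  · simp [Real.zero_rpow hm₁.ne', Real.zero_rpow hm₂.ne']

theorem IsClassK.nonneg {γ : ℝ → ℝ} (h : IsClassK γ) {s : ℝ} (hs : 0 ≤ s) : 0 ≤ γ s :=
  h.map_zero ▸ h.strictMonoOn.monotoneOn self_mem_Ici hs hs

theorem IsClassK.continuousOn_comp_norm {γ : ℝ → ℝ} (h : IsClassK γ) {U : Type*}
    [NormedAddCommGroup U] {u : ℝ → U} {s : Set ℝ} (hu : ContinuousOn u s) :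
    ContinuousOn (fun t => γ ‖u t‖) s :=
  h.continuousOn.comp hu.norm fun _ _ => norm_nonneg _

/-- The summand `exp (-t)` makes the function strictly decreasing in `t` also where `K` is
constant. -/
theorem isClassKL_mul_exp {D : ℝ} (hD : 0 < D) {K : ℝ → ℝ} (hKc : ContinuousOn K (Ici 0))
    (hKm : MonotoneOn K (Ici 0)) (hK : Tendsto K atTop atTop) :
    IsClassKL (fun r t => D * r * (Real.exp (-K t) + Real.exp (-t))) := by
  have hpos : ∀ t, 0 < Real.exp (-K t) + Real.exp (-t) := fun t => by positivity
  have hEc : ContinuousOn (fun t => Real.exp (-K t) + Real.exp (-t)) (Ici 0) :=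
    (hKc.neg.rexp).add (by fun_prop)
  refine ⟨?_, ?_, ?_⟩
  · refine ContinuousOn.mul (by fun_prop) ?_
    exact hEc.comp continuousOn_snd fun p hp => hp.2
  · intro t _
    refine ⟨by fun_prop, ?_, by simp⟩
    intro a _ b _ hab
    exact mul_lt_mul_of_pos_right (mul_lt_mul_of_pos_left hab hD) (hpos t)
  · intro r hr
    refine ⟨continuousOn_const.mul hEc, ?_, ?_⟩
    · intro a ha b hb hab
      refine mul_lt_mul_of_pos_left ?_ (mul_pos hD hr)
      exact add_lt_add_of_le_of_lt
        (Real.exp_le_exp.2 (neg_le_neg (hKm ha hb hab.le))) (Real.exp_lt_exp.2 (neg_lt_neg hab))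
    · have h1 := (Real.tendsto_exp_neg_atTop_nhds_zero.comp hK).add
        Real.tendsto_exp_neg_atTop_nhds_zero
      simpa using h1.const_mul (D * r)

/-! ### Decay along classical solutions -/

theorem intervalIntegrable_of_locallyIntegrableOn_Ici {a : ℝ → ℝ}
    (ha : LocallyIntegrableOn a (Ici 0)) {s t : ℝ} (hs : 0 ≤ s) (ht : 0 ≤ t) :
    IntervalIntegrable a volume s t := by
  rw [intervalIntegrable_iff]
  refine (ha.integrableOn_compact_subset ?_ (isCompact_uIcc (a := s) (b := t))).mono_set
    uIoc_subset_uIcc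
  exact fun r hr => (le_min hs ht).trans hr.1

theorem continuousOn_primitive_of_locallyIntegrableOn {a : ℝ → ℝ}
    (ha : LocallyIntegrableOn a (Ici 0)) :
    ContinuousOn (fun t => ∫ s in (0 : ℝ)..t, a s) (Ici 0) := by
  intro t (ht : 0 ≤ t)
  have h0 : (0 : ℝ) ≤ t + 1 := by linarith
  have h := intervalIntegral.continuousOn_primitive_interval'
    (intervalIntegrable_of_locallyIntegrableOn_Ici ha le_rfl h0) left_mem_uIcc
  rw [uIcc_of_le h0] at h
  refine (h t ⟨ht, by linarith⟩).mono_of_mem_nhdsWithin ?_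
  filter_upwards [self_mem_nhdsWithin, mem_nhdsWithin_of_mem_nhds (Iic_mem_nhds (lt_add_one t))]
    with s hs hs' using ⟨hs, hs'⟩

theorem monotoneOn_primitive_of_nonneg {a : ℝ → ℝ} (ha : LocallyIntegrableOn a (Ici 0))
    (h0 : ∀ t, 0 ≤ t → 0 ≤ a t) : MonotoneOn (fun t => ∫ s in (0 : ℝ)..t, a s) (Ici 0) := by
  intro s (hs : 0 ≤ s) t (ht : 0 ≤ t) hst
  have h := intervalIntegral.integral_add_adjacent_intervals
    (intervalIntegrable_of_locallyIntegrableOn_Ici ha le_rfl hs)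
    (intervalIntegrable_of_locallyIntegrableOn_Ici ha hs ht)
  have h1 : 0 ≤ ∫ r in s..t, a r :=
    intervalIntegral.integral_nonneg hst fun r hr => h0 r (hs.trans hr.1)
  simp only
  linarith

theorem Icc_subset_of_coe_lt {t : ℝ} {T : EReal} (hT : (t : EReal) < T) :
    Icc 0 t ⊆ {s : ℝ | 0 ≤ s ∧ (s : EReal) < T} := fun _ hs =>
  ⟨hs.1, (EReal.coe_le_coe_iff.2 hs.2).trans_lt hT⟩

namespace EvolutionSystem

section Solutions

variable {𝕜 X U : Type*} [RCLike 𝕜] [NormedAddCommGroup X] [NormedSpace 𝕜 X]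
  [NormedSpace ℝ X]

theorem IsClassicalSolution.hasDerivAt_functional {S : EvolutionSystem 𝕜 X U} {x₀ : X}
    {u : ℝ → U} {T : EReal} {x : ℝ → X} (hx : S.IsClassicalSolution x₀ u T x) {V : ℝ → X → ℝ}
    (hV : ContDiffOn ℝ 1 (Function.uncurry V) (Ici (0 : ℝ) ×ˢ (univ : Set X)))
    {t : ℝ} (h0 : 0 < t) (hT : (t : EReal) < T) :
    HasDerivAt (fun s => V s (x s))
      (S.orbitalDeriv V t ⟨x t, hx.mem_domain t h0 hT⟩ (u t)) t := by
  have h1 : HasFDerivAt (Function.uncurry V)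
      (fderivWithin ℝ (Function.uncurry V) (Ici 0 ×ˢ univ) (t, x t)) (t, x t) :=
    ((hV.differentiableOn one_ne_zero (t, x t) ⟨h0.le, mem_univ _⟩).hasFDerivWithinAt).hasFDerivAt
      (prod_mem_nhds (Ici_mem_nhds h0) univ_mem)
  have h2 : HasDerivAt (fun s => (s, x s))
      ((1 : ℝ), S.rhs t ⟨x t, hx.mem_domain t h0 hT⟩ (u t)) t :=
    (hasDerivAt_id t).prodMk (hx.hasDerivAt t h0 hT)
  exact h1.comp_hasDerivAt t h2

variable [NormedAddCommGroup U]

/-- The dissipation inequality is only needed along the solution and at the interior times, so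
that the lemma also applies up to the first exit time from a ball. -/
theorem IsClassicalSolution.functional_le {S : EvolutionSystem 𝕜 X U} {x₀ : X}
    {u : ℝ → U} {T : EReal} {x : ℝ → X} (hx : S.IsClassicalSolution x₀ u T x)
    (hu : ContinuousOn u (Ici 0)) {V : ℝ → X → ℝ}
    (hV : ContDiffOn ℝ 1 (Function.uncurry V) (Ici (0 : ℝ) ×ˢ (univ : Set X)))
    {C : ℝ} (hC : 0 < C) (hV0 : ∀ t, 0 ≤ t → ∀ y, 0 ≤ V t y)
    (hVC : ∀ t, 0 ≤ t → ∀ y, V t y ≤ C * ‖y‖ ^ 2)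
    {a ζ : ℝ → ℝ} (ha : ∀ t, 0 ≤ t → 0 ≤ a t) (hai : LocallyIntegrableOn a (Ici 0))
    (hζ : IsClassK ζ) {t : ℝ} (h0 : 0 ≤ t) (hT : (t : EReal) < T)
    (hdecay : ∀ s ∈ Ioo 0 t, ∀ y : (S.A s).domain, (y : X) = x s →
      S.orbitalDeriv V s y (u s) ≤ -a s * ‖x s‖ ^ 2 + ζ ‖u s‖) :
    V t (x t) ≤ C * ‖x₀‖ ^ 2 * Real.exp (-∫ s in (0 : ℝ)..t, a s / C)
      + ∫ s in (0 : ℝ)..t, ζ ‖u s‖ := by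
  have hsub := Icc_subset_of_coe_lt hT
  have hxc : ContinuousOn x (Icc 0 t) := hx.continuousOn.mono hsub
  have key := le_mul_exp_add_integral_of_deriv_le (W := fun s => V s (x s))
    (W' := deriv fun s => V s (x s)) (k := fun s => a s / C) (z := fun s => ζ ‖u s‖) h0
    ?_ (fun s hs => hV0 s hs.1 _) ?_ (fun s hs => div_nonneg (ha s hs.1.le) hC.le) ?_
    (hζ.continuousOn_comp_norm hu) (fun s _ => hζ.nonneg (norm_nonneg _)) ?_
  · refine key.trans (add_le_add_left ?_ _)
    refine mul_le_mul_of_nonneg_right ?_ (Real.exp_nonneg _)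
    simpa [hx.initial] using hVC 0 le_rfl (x 0)
  · exact hV.continuousOn.comp (continuousOn_id.prodMk hxc) fun s hs => ⟨hs.1, mem_univ _⟩
  · intro s hs
    exact (hx.hasDerivAt_functional hV hs.1
      (hsub (Ioo_subset_Icc_self hs)).2).differentiableAt.hasDerivAt
  · exact (hai.integrableOn_compact_subset Icc_subset_Ici_self isCompact_Icc).div_const C
  · intro s hs
    have hsT := (hsub (Ioo_subset_Icc_self hs)).2
    rw [(hx.hasDerivAt_functional hV hs.1 hsT).deriv]
    refine (hdecay s hs _ rfl).trans (add_le_add_left ?_ _)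
    have h1 : a s / C * V s (x s) ≤ a s / C * (C * ‖x s‖ ^ 2) :=
      mul_le_mul_of_nonneg_left (hVC s hs.1.le _) (div_nonneg (ha s hs.1.le) hC.le)
    have h2 : a s / C * (C * ‖x s‖ ^ 2) = a s * ‖x s‖ ^ 2 := by field_simp
    linarith

/-- A first-exit-time argument: at the first time at which `‖x‖ = ρ`, the decay estimate, which
holds up to that time, would give `c ρ² ≤ V ≤ C R² + R`. -/
theorem IsClassicalSolution.norm_lt_of_decay_on_ball {S : EvolutionSystem 𝕜 X U} {x₀ : X}
    {u : ℝ → U} {T : EReal} {x : ℝ → X} (hx : S.IsClassicalSolution x₀ u T x)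
    (hu : ContinuousOn u (Ici 0)) {V : ℝ → X → ℝ}
    (hV : ContDiffOn ℝ 1 (Function.uncurry V) (Ici (0 : ℝ) ×ˢ (univ : Set X)))
    {c C : ℝ} (hc : 0 < c) (hC : 0 < C) (hVc : ∀ t, 0 ≤ t → ∀ y, c * ‖y‖ ^ 2 ≤ V t y)
    (hVC : ∀ t, 0 ≤ t → ∀ y, V t y ≤ C * ‖y‖ ^ 2)
    {a ζ : ℝ → ℝ} (ha : ∀ t, 0 ≤ t → 0 ≤ a t) (hai : LocallyIntegrableOn a (Ici 0))
    (hζ : IsClassK ζ) {ρ R : ℝ} (hρ : 0 < ρ) (hR : C * R ^ 2 + R < c * ρ ^ 2)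
    (hdecay : ∀ s, 0 ≤ s → ∀ (y : (S.A s).domain) (v : U), ‖(y : X)‖ < ρ →
      S.orbitalDeriv V s y v ≤ -a s * ‖(y : X)‖ ^ 2 + ζ ‖v‖)
    (hsmall : ∀ t : ℝ, 0 < t → ‖x₀‖ + ∫ s in (0 : ℝ)..t, ζ ‖u s‖ ≤ R)
    {t : ℝ} (h0 : 0 ≤ t) (hT : (t : EReal) < T) : ‖x t‖ < ρ := by
  by_contra! hge
  have hsub := Icc_subset_of_coe_lt hT
  have hxc : ContinuousOn (fun s => ‖x s‖) (Icc 0 t) := (hx.continuousOn.mono hsub).norm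
  have hcpt : IsCompact (Icc 0 t ∩ (fun s => ‖x s‖) ⁻¹' Ici ρ) :=
    isCompact_Icc.of_isClosed_subset (hxc.preimage_isClosed_of_isClosed isClosed_Icc isClosed_Ici)
      inter_subset_left
  obtain ⟨τ, ⟨hτ, hτρ⟩, hmin⟩ := hcpt.exists_isLeast ⟨t, ⟨h0, le_rfl⟩, hge⟩
  have hzn : ∀ s, 0 ≤ ζ ‖u s‖ := fun s => hζ.nonneg (norm_nonneg _)
  have hin : ∀ s, 0 ≤ s → 0 ≤ ∫ r in (0 : ℝ)..s, ζ ‖u r‖ := fun s hs =>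
    intervalIntegral.integral_nonneg hs fun r _ => hzn r
  have hx₀ : ‖x₀‖ ≤ R := by linarith [hsmall 1 one_pos, hin 1 zero_le_one]
  have hint : ∫ r in (0 : ℝ)..τ, ζ ‖u r‖ ≤ R := by
    rcases hτ.1.eq_or_lt with h | h
    · rw [← h, intervalIntegral.integral_same]; exact (norm_nonneg _).trans hx₀
    · linarith [hsmall τ h, norm_nonneg x₀]
  have key := hx.functional_le hu hV hC
    (fun s hs y => (mul_nonneg hc.le (sq_nonneg _)).trans (hVc s hs y)) hVC ha hai hζ hτ.1
    (hsub hτ).2 (by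
      intro s hs y hy
      rw [← hy]
      refine hdecay s hs.1.le y _ ?_
      by_contra! hle
      rw [hy] at hle
      exact absurd (hmin ⟨⟨hs.1.le, hs.2.le.trans hτ.2⟩, hle⟩) (not_le.2 hs.2))
  have hexp : Real.exp (-∫ s in (0 : ℝ)..τ, a s / C) ≤ 1 := by
    rw [Real.exp_le_one_iff, neg_nonpos]
    exact intervalIntegral.integral_nonneg hτ.1 fun r hr => div_nonneg (ha r hr.1) hC.le
  have h1 : C * ‖x₀‖ ^ 2 * Real.exp (-∫ s in (0 : ℝ)..τ, a s / C) ≤ C * R ^ 2 := by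
    refine (mul_le_of_le_one_right (by positivity) hexp).trans ?_
    gcongr
  have h2 : c * ρ ^ 2 ≤ c * ‖x τ‖ ^ 2 := by
    have : ρ ≤ ‖x τ‖ := hτρ
    gcongr
  linarith [hVc τ hτ.1 (x τ)]

theorem norm_le_of_mul_sq_le {c C r n K I t : ℝ} (hc : 0 < c) (hC : 0 < C) (hr : 0 ≤ r)
    (hI : 0 ≤ I) (h : c * n ^ 2 ≤ C * r ^ 2 * Real.exp (-K) + I) :
    n ≤ √(C / c) * r * (Real.exp (-(K / 2)) + Real.exp (-t)) + √(I / c) := by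
  set p := √(C / c) * r * Real.exp (-(K / 2)) with hp
  have hp0 : 0 ≤ p := by positivity
  have hq0 : 0 ≤ √(I / c) := Real.sqrt_nonneg _
  have hp2 : p ^ 2 = C / c * r ^ 2 * Real.exp (-K) := by
    rw [hp, mul_pow, mul_pow, Real.sq_sqrt (by positivity), ← Real.exp_nat_mul]
    congr 2
    push_cast
    ring
  have hq2 : √(I / c) ^ 2 = I / c := Real.sq_sqrt (by positivity)
  have hn : n ≤ p + √(I / c) := by
    refine le_of_sq_le_sq ?_ (by positivity)
    have : n ^ 2 ≤ p ^ 2 + √(I / c) ^ 2 := by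
      rw [hp2, hq2]
      have : C / c * r ^ 2 * Real.exp (-K) + I / c = (C * r ^ 2 * Real.exp (-K) + I) / c := by
        field_simp
      rw [this, le_div_iff₀ hc]
      linarith
    nlinarith [mul_nonneg hp0 hq0]
  have : 0 ≤ √(C / c) * r * Real.exp (-t) := by positivity
  rw [mul_add]
  linarith

end Solutions

/-! ### Quadratic functionals -/

section QuadraticFunctional

variable {𝕜 X U : Type*} [RCLike 𝕜] [NormedAddCommGroup X] [InnerProductSpace 𝕜 X]

theorem re_inner_apply_le {C : ℝ} {Q : X →L[𝕜] X} (hQ : ‖Q‖ ≤ C) (x : X) :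
    RCLike.re (inner 𝕜 (Q x) x) ≤ C * ‖x‖ ^ 2 := by
  calc RCLike.re (inner 𝕜 (Q x) x) ≤ ‖Q x‖ * ‖x‖ := re_inner_le_norm _ _
    _ ≤ C * ‖x‖ * ‖x‖ := by gcongr; exact Q.le_of_opNorm_le hQ x
    _ = C * ‖x‖ ^ 2 := by ring

variable [NormedSpace ℝ X] [IsScalarTower ℝ 𝕜 X] {P : ℝ → X →L[𝕜] X}

theorem contDiffOn_re_inner_apply (hP : ContDiffOn ℝ 1 P (Ici 0)) :
    ContDiffOn ℝ 1 (Function.uncurry fun t x => RCLike.re (inner 𝕜 (P t x) x))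
      (Ici (0 : ℝ) ×ˢ (univ : Set X)) := by
  have h1 : ContDiffOn ℝ 1
      (fun p : ℝ × X => ContinuousLinearMap.restrictScalarsL 𝕜 X X ℝ ℝ (P p.1))
      (Ici (0 : ℝ) ×ˢ (univ : Set X)) :=
    (ContinuousLinearMap.restrictScalarsL 𝕜 X X ℝ ℝ).contDiff.comp_contDiffOn
      (hP.comp contDiff_fst.contDiffOn fun p hp => hp.1)
  have h2 : ContDiffOn ℝ 1 (fun p : ℝ × X => P p.1 p.2) (Ici (0 : ℝ) ×ˢ (univ : Set X)) :=
    h1.clm_apply contDiff_snd.contDiffOn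
  exact (RCLike.reCLM (K := 𝕜)).contDiff.comp_contDiffOn (h2.inner 𝕜 contDiff_snd.contDiffOn)

/-- The directional derivative is computed along the curve `s ↦ (s, x + (s - t) v)` with
`v = A(t) x + F(t, x, u)`. -/
theorem orbitalDeriv_re_inner_apply (S : EvolutionSystem 𝕜 X U) (hP : ContDiffOn ℝ 1 P (Ici 0))
    {t : ℝ} (ht : 0 ≤ t) (hsymm : (P t).IsSymmetric) (x : (S.A t).domain) (u : U) :
    S.orbitalDeriv (fun t x => RCLike.re (inner 𝕜 (P t x) x)) t x u =
      lyapunovForm (S.A t) (P t) (derivWithin P (Ici 0) t) x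
        + 2 * RCLike.re (inner 𝕜 (S.nonlin t x u) (P t x)) := by
  set v : X := S.rhs t x u with hv
  have hline : HasDerivWithinAt (fun s : ℝ => (x : X) + (s - t) • v) v (Ici 0) t := by
    simpa using ((((hasDerivAt_id t).sub_const t).smul_const v).const_add (x : X)).hasDerivWithinAt
  have hPt : HasDerivWithinAt (fun s => ContinuousLinearMap.restrictScalarsL 𝕜 X X ℝ ℝ (P s))
      (ContinuousLinearMap.restrictScalarsL 𝕜 X X ℝ ℝ (derivWithin P (Ici 0) t)) (Ici 0) t :=
    (ContinuousLinearMap.restrictScalarsL 𝕜 X X ℝ ℝ).hasFDerivAt.comp_hasDerivWithinAt t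
      ((hP.differentiableOn one_ne_zero) t ht).hasDerivWithinAt
  have hPx : HasDerivWithinAt (fun s => P s ((x : X) + (s - t) • v))
      (derivWithin P (Ici 0) t x + P t v) (Ici 0) t := by
    simpa using hPt.clm_apply hline
  have h1 : HasDerivWithinAt
      (fun s => RCLike.re (inner 𝕜 (P s ((x : X) + (s - t) • v)) ((x : X) + (s - t) • v)))
      (RCLike.re (inner 𝕜 (P t x) v + inner 𝕜 (derivWithin P (Ici 0) t x + P t v) (x : X)))
      (Ici 0) t := by
    have h := (RCLike.reCLM (K := 𝕜)).hasFDerivAt.comp_hasDerivWithinAt t (hPx.inner 𝕜 hline)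
    simp only [sub_self, zero_smul, add_zero] at h
    exact h
  have hmem : ((t, (x : X)) : ℝ × X) ∈ Ici (0 : ℝ) ×ˢ (univ : Set X) := ⟨ht, mem_univ _⟩
  have hV := (((contDiffOn_re_inner_apply hP).differentiableOn one_ne_zero)
    _ hmem).hasFDerivWithinAt
  have hcurve : HasDerivWithinAt (fun s : ℝ => (s, (x : X) + (s - t) • v)) (1, v) (Ici 0) t :=
    (hasDerivWithinAt_id t _).prodMk hline
  have h2 := hV.comp_hasDerivWithinAt_of_eq t hcurve
    (fun s hs => ⟨hs, mem_univ _⟩) (by simp)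
  have huniq := (uniqueDiffOn_Ici (0 : ℝ) t ht).eq_deriv _ h2 h1
  rw [orbitalDeriv, ← hv]
  refine huniq.trans ?_
  have e1 : inner 𝕜 (P t (S.nonlin t x u)) (x : X) = inner 𝕜 (S.nonlin t x u) (P t x) :=
    hsymm _ _
  have e2 : RCLike.re (inner 𝕜 (P t x) (S.nonlin t x u)) =
      RCLike.re (inner 𝕜 (S.nonlin t x u) (P t x)) := inner_re_symm _ _
  simp only [hv, rhs, lyapunovForm, map_add, inner_add_left, inner_add_right, e1, e2]
  ring

end QuadraticFunctional

/-! ### Absorbing the superquadratic terms near the origin -/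

theorem exists_mul_rpow_add_rpow_le_sq {L m₁ m₂ : ℝ} (hm₁ : 2 < m₁)
    (hm₂ : 2 < m₂) :
    ∃ ρ : ℝ, 0 < ρ ∧ ∀ s ∈ Icc 0 ρ, L * (s ^ m₁ + s ^ m₂) ≤ s ^ 2 := by
  have hcont : ContinuousAt (fun s : ℝ => L * (s ^ (m₁ - 2) + s ^ (m₂ - 2))) 0 :=
    (continuous_const.mul ((Real.continuous_rpow_const (by linarith)).add
      (Real.continuous_rpow_const (by linarith)))).continuousAt
  have h0 : L * ((0 : ℝ) ^ (m₁ - 2) + (0 : ℝ) ^ (m₂ - 2)) < 1 := by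
    rw [Real.zero_rpow (by linarith), Real.zero_rpow (by linarith)]
    simp
  obtain ⟨ε, hε, hb⟩ := Metric.eventually_nhds_iff.1 (hcont.eventually_lt_const h0)
  refine ⟨ε / 2, by positivity, fun s hs => ?_⟩
  rcases hs.1.eq_or_lt with rfl | hs0
  · rw [Real.zero_rpow (by linarith), Real.zero_rpow (by linarith)]
    simp
  have h1 : L * (s ^ (m₁ - 2) + s ^ (m₂ - 2)) < 1 := by
    refine hb ?_
    rw [Real.dist_eq, sub_zero, abs_of_pos hs0]
    linarith [hs.2]
  have e : ∀ m : ℝ, s ^ m = s ^ (m - 2) * s ^ 2 := fun m => by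
    rw [← Real.rpow_natCast s 2, ← Real.rpow_add hs0]
    norm_num
  rw [e m₁, e m₂, ← add_mul, ← mul_assoc]
  exact mul_le_of_le_one_left (sq_nonneg _) h1.le

/-- With `q = s ^ m₁ + s ^ m₂`, the superquadratic terms use up at most half of the decay as long as
`2 M q ≤ s ^ 2`. -/
theorem decay_of_superquadratic_le {a₁ a₂ M s q e₀ : ℝ} (ha₁ : 0 ≤ a₁)
    (hle : a₂ ≤ M * a₁) (hq0 : 0 ≤ q) (hq : 2 * M * q ≤ s ^ 2)
    (he : e₀ ≤ -a₁ * s ^ 2 + a₂ * q) : e₀ ≤ -(a₁ / 2) * s ^ 2 := by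
  nlinarith [mul_le_mul_of_nonneg_right hle hq0, mul_le_mul_of_nonneg_left hq ha₁]

/-! ### Stability from a decay estimate -/

section Stability

variable {𝕜 X U : Type*} [RCLike 𝕜] [NormedAddCommGroup X] [NormedSpace 𝕜 X]
  [NormedSpace ℝ X] [NormedAddCommGroup U]

theorem isClassKL_of_divergent_rate {D C : ℝ} (hD : 0 < D) (hC : 0 < C) {a : ℝ → ℝ}
    (ha : ∀ t, 0 ≤ t → 0 ≤ a t) (hai : LocallyIntegrableOn a (Ici 0))
    (hdiv : Tendsto (fun t : ℝ => ∫ τ in (0 : ℝ)..t, a τ) atTop atTop) :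
    IsClassKL (fun r t =>
      D * r * (Real.exp (-((∫ τ in (0 : ℝ)..t, a τ / C) / 2)) + Real.exp (-t))) := by
  simp only [intervalIntegral.integral_div]
  refine isClassKL_mul_exp hD ?_ ?_ ((hdiv.atTop_div_const hC).atTop_div_const two_pos)
  · exact ((continuousOn_primitive_of_locallyIntegrableOn hai).div_const C).div_const 2
  · intro s hs t ht hst
    have := monotoneOn_primitive_of_nonneg hai ha hs ht hst
    simp only at this ⊢
    gcongr

/-- A functional comparable with `‖x‖ ^ 2` that decays at a divergent rate everywhere. -/
theorem isIISS_of_decay (S : EvolutionSystem 𝕜 X U) {V : ℝ → X → ℝ}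
    (hV : ContDiffOn ℝ 1 (Function.uncurry V) (Ici (0 : ℝ) ×ˢ (univ : Set X)))
    {c C : ℝ} (hc : 0 < c) (hC : 0 < C) (hVc : ∀ t, 0 ≤ t → ∀ y, c * ‖y‖ ^ 2 ≤ V t y)
    (hVC : ∀ t, 0 ≤ t → ∀ y, V t y ≤ C * ‖y‖ ^ 2)
    {a ζ : ℝ → ℝ} (ha : ∀ t, 0 ≤ t → 0 ≤ a t) (hai : LocallyIntegrableOn a (Ici 0))
    (hdiv : Tendsto (fun t : ℝ => ∫ τ in (0 : ℝ)..t, a τ) atTop atTop) (hζ : IsClassK ζ)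
    (hdecay : ∀ s, 0 ≤ s → ∀ (y : (S.A s).domain) (v : U),
      S.orbitalDeriv V s y v ≤ -a s * ‖(y : X)‖ ^ 2 + ζ ‖v‖) : S.IsIISS := by
  refine ⟨_, _, ζ, isClassKL_of_divergent_rate (Real.sqrt_pos.2 (div_pos hC hc)) hC ha hai hdiv,
    isClassKInf_sqrt_div hc, hζ, ?_⟩
  intro x₀ u _ hu T x hx t h0 hT
  refine norm_le_of_mul_sq_le hc hC (norm_nonneg _)
    (intervalIntegral.integral_nonneg h0 fun s _ => hζ.nonneg (norm_nonneg _))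
    ((hVc t h0 (x t)).trans ?_)
  refine hx.functional_le hu hV hC
    (fun s hs y => (mul_nonneg hc.le (sq_nonneg _)).trans (hVc s hs y)) hVC ha hai hζ h0 hT ?_
  intro s hs y hy
  rw [← hy]
  exact hdecay s hs.1.le y _

/-- If the decay is only known on the ball of radius `ρ`, it suffices to restrict to data that
cannot leave this ball. -/
theorem isLiISS_of_decay_on_ball (S : EvolutionSystem 𝕜 X U) {V : ℝ → X → ℝ}
    (hV : ContDiffOn ℝ 1 (Function.uncurry V) (Ici (0 : ℝ) ×ˢ (univ : Set X)))
    {c C : ℝ} (hc : 0 < c) (hC : 0 < C) (hVc : ∀ t, 0 ≤ t → ∀ y, c * ‖y‖ ^ 2 ≤ V t y)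
    (hVC : ∀ t, 0 ≤ t → ∀ y, V t y ≤ C * ‖y‖ ^ 2)
    {a ζ : ℝ → ℝ} (ha : ∀ t, 0 ≤ t → 0 ≤ a t) (hai : LocallyIntegrableOn a (Ici 0))
    (hdiv : Tendsto (fun t : ℝ => ∫ τ in (0 : ℝ)..t, a τ) atTop atTop) (hζ : IsClassK ζ)
    {ρ : ℝ} (hρ : 0 < ρ)
    (hdecay : ∀ s, 0 ≤ s → ∀ (y : (S.A s).domain) (v : U), ‖(y : X)‖ < ρ →
      S.orbitalDeriv V s y v ≤ -a s * ‖(y : X)‖ ^ 2 + ζ ‖v‖) : S.IsLiISS := by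
  obtain ⟨R, hR0, hR⟩ : ∃ R : ℝ, 0 < R ∧ C * R ^ 2 + R < c * ρ ^ 2 := by
    have hcont : ContinuousAt (fun R : ℝ => C * R ^ 2 + R) 0 := by fun_prop
    have h0 : C * (0 : ℝ) ^ 2 + 0 < c * ρ ^ 2 := by
      have : 0 < c * ρ ^ 2 := by positivity
      simpa using this
    have hev := (hcont.eventually_lt_const h0).filter_mono (nhdsWithin_le_nhds (s := Ioi 0))
    obtain ⟨R, h1, h2⟩ := (hev.and self_mem_nhdsWithin).exists
    exact ⟨R, h2, h1⟩
  refine ⟨_, _, ζ, R, fun s => s, ζ,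
    isClassKL_of_divergent_rate (Real.sqrt_pos.2 (div_pos hC hc)) hC ha hai hdiv,
    isClassKInf_sqrt_div hc, hζ, hR0, isClassKInf_id, hζ, ?_⟩
  intro x₀ u _ hu hsmall T x hx t h0 hT
  refine norm_le_of_mul_sq_le hc hC (norm_nonneg _)
    (intervalIntegral.integral_nonneg h0 fun s _ => hζ.nonneg (norm_nonneg _))
    ((hVc t h0 (x t)).trans ?_)
  refine hx.functional_le hu hV hC
    (fun s hs y => (mul_nonneg hc.le (sq_nonneg _)).trans (hVc s hs y)) hVC ha hai hζ h0 hT ?_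
  intro s hs y hy
  rw [← hy]
  refine hdecay s hs.1.le y _ ?_
  rw [hy]
  exact hx.norm_lt_of_decay_on_ball hu hV hc hC hVc hVC ha hai hζ hρ hR hdecay hsmall hs.1.le
    (Icc_subset_of_coe_lt hT (Ioo_subset_Icc_self hs)).2

end Stability

end EvolutionSystem

theorem theorem2 {𝕜 X U : Type*} [RCLike 𝕜]
    [NormedAddCommGroup X] [InnerProductSpace 𝕜 X] [CompleteSpace X]
    [NormedSpace ℝ X] [IsScalarTower ℝ 𝕜 X]
    [NormedAddCommGroup U] [NormedSpace 𝕜 U]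
    (S : EvolutionSystem 𝕜 X U)
    (P : ℝ → X →L[𝕜] X)
    (hP_C1 : ContDiffOn ℝ 1 P (Ici 0))
    (hP_bdd : ∃ C : ℝ, ∀ t : ℝ, 0 ≤ t → ‖P t‖ ≤ C)
    (hP_pos : ∀ t : ℝ, 0 ≤ t → (P t).IsPositive)
    (hP_coercive : ∃ c : ℝ, 0 < c ∧ ∀ t : ℝ, 0 ≤ t → ∀ x : X,
      c * ‖x‖ ^ 2 ≤ RCLike.re (inner 𝕜 (P t x) x))
    (a₁ a₂ : ℝ → ℝ)
    (ha₁_nonneg : ∀ t : ℝ, 0 ≤ t → 0 ≤ a₁ t)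
    (ha₂_nonneg : ∀ t : ℝ, 0 ≤ t → 0 ≤ a₂ t)
    (ha₁_int : LocallyIntegrableOn a₁ (Ici 0))
    (ha₂_int : LocallyIntegrableOn a₂ (Ici 0))
    (ha₁_div : Tendsto (fun t : ℝ => ∫ τ in (0 : ℝ)..t, a₁ τ) atTop atTop)
    (M : ℝ) (hM : 0 ≤ M) (ha₂_le : ∀ t : ℝ, 0 ≤ t → a₂ t ≤ M * a₁ t)
    (m₁ m₂ : ℝ) (hm₁ : 2 < m₁) (hm₂ : 2 < m₂)
    (ζ : ℝ → ℝ) (hζ : IsClassK ζ)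
    (hineq : ∀ t : ℝ, 0 ≤ t → ∀ (x : (S.A t).domain) (u : U),
      lyapunovForm (S.A t) (P t) (derivWithin P (Ici 0) t) x
          + 2 * RCLike.re (inner 𝕜 (S.nonlin t x u) (P t x))
        ≤ -a₁ t * ‖(x : X)‖ ^ 2 + a₂ t * (‖(x : X)‖ ^ m₁ + ‖(x : X)‖ ^ m₂) + ζ ‖u‖) :
    S.IsLiISSLyapunov (fun t x => RCLike.re (inner 𝕜 (P t x) x)) ∧
    S.IsLiISS ∧
    ((∀ t : ℝ, 0 ≤ t → a₂ t = 0) →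
      S.IsIISSLyapunov (fun t x => RCLike.re (inner 𝕜 (P t x) x)) ∧ S.IsIISS) := by
  obtain ⟨C₀, hC₀⟩ := hP_bdd
  obtain ⟨c, hc, hcoer⟩ := hP_coercive
  -- `|C₀| + 1` is positive also when `X` is trivial
  set C : ℝ := |C₀| + 1 with hC_def
  have hC : 0 < C := by positivity
  set V : ℝ → X → ℝ := fun t x => RCLike.re (inner 𝕜 (P t x) x) with hV_def
  have hVC : ∀ t, 0 ≤ t → ∀ y, V t y ≤ C * ‖y‖ ^ 2 := fun t ht y =>
    EvolutionSystem.re_inner_apply_le ((hC₀ t ht).trans (by linarith [le_abs_self C₀])) y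
  have hV1 : ContDiffOn ℝ 1 (Function.uncurry V) (Ici (0 : ℝ) ×ˢ (univ : Set X)) :=
    EvolutionSystem.contDiffOn_re_inner_apply hP_C1
  have hdiss : ∀ t : ℝ, 0 ≤ t → ∀ (x : (S.A t).domain) (u : U),
      S.orbitalDeriv V t x u ≤ -a₁ t * ‖(x : X)‖ ^ 2
        + a₂ t * (‖(x : X)‖ ^ m₁ + ‖(x : X)‖ ^ m₂) + ζ ‖u‖ := fun t ht x u => by
    rw [hV_def, EvolutionSystem.orbitalDeriv_re_inner_apply S hP_C1 ht (hP_pos t ht).isSymmetric]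
    exact hineq t ht x u
  have hcand : EvolutionSystem.IsLyapunovCandidate V :=
    ⟨hV1, _, _, isClassKInf_mul_sq hc, isClassKInf_mul_sq hC,
      fun t ht x => ⟨hcoer t ht x, hVC t ht x⟩⟩
  have hM1 : 0 < M + 1 := by linarith
  obtain ⟨r, hr, hrle⟩ := EvolutionSystem.exists_mul_rpow_add_rpow_le_sq (L := M + 1) hm₁ hm₂
  -- dividing `a₂` by `M + 1` gives `g₂ ≤ g₁ = a₁`; the factor goes into the gain `θ₂`
  have hD : S.Dissipation V a₁ (fun t => a₂ t / (M + 1)) := by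
    refine ⟨ha₁_int, ?_, ?_, ha₁_div, fun s => 1 * s ^ 2,
      fun s => (M + 1) * (s ^ m₁ + s ^ m₂), ζ, r, (isClassKInf_mul_sq one_pos).isClassK,
      isClassK_mul_rpow_add_rpow hM1 (by linarith) (by linarith), hζ, hr, ?_, ?_⟩
    · simp only [div_eq_inv_mul]
      exact ha₂_int.smul (M + 1)⁻¹
    · intro t ht
      refine ⟨ha₁_nonneg t ht, div_nonneg (ha₂_nonneg t ht) hM1.le, ?_⟩
      rw [div_le_iff₀ hM1]
      linarith [ha₂_le t ht, ha₁_nonneg t ht]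
    · intro s hs
      simpa using hrle s hs
    · intro t ht x u
      have e : a₂ t / (M + 1) * ((M + 1) * (‖(x : X)‖ ^ m₁ + ‖(x : X)‖ ^ m₂)) =
          a₂ t * (‖(x : X)‖ ^ m₁ + ‖(x : X)‖ ^ m₂) := by field_simp
      simpa only [e, one_mul] using hdiss t ht x u
  refine ⟨⟨hcand, _, _, hD⟩, ?_, fun h0 => ⟨⟨hcand, _, _, fun t ht => ?_, hD⟩, ?_⟩⟩
  · obtain ⟨ρ, hρ, hρle⟩ := EvolutionSystem.exists_mul_rpow_add_rpow_le_sq (L := 2 * M) hm₁ hm₂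
    refine EvolutionSystem.isLiISS_of_decay_on_ball S hV1 hc hC hcoer hVC (a := fun t => a₁ t / 2)
      (fun t ht => div_nonneg (ha₁_nonneg t ht) two_pos.le) ?_ ?_ hζ hρ ?_
    · simp only [div_eq_inv_mul]
      exact ha₁_int.smul (2 : ℝ)⁻¹
    · simpa only [intervalIntegral.integral_div] using ha₁_div.atTop_div_const two_pos
    · intro t ht x u hx
      have h := EvolutionSystem.decay_of_superquadratic_le (e₀ := S.orbitalDeriv V t x u - ζ ‖u‖)
        (ha₁_nonneg t ht) (ha₂_le t ht) (by positivity)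
        (hρle ‖(x : X)‖ ⟨norm_nonneg _, hx.le⟩) (by linarith [hdiss t ht x u])
      linarith
  · simp [h0 t ht]
  · refine EvolutionSystem.isIISS_of_decay S hV1 hc hC hcoer hVC ha₁_nonneg ha₁_int ha₁_div hζ ?_
    intro t ht x u
    simpa [h0 t ht] using hdiss t ht x u
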